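/- Let $\mathcal V$ be a countably infinite set of variables and let $\mathcal P=\{0,1,2\}^{*}$ be the set of positions (finite sequences, ordered by the prefix order $\le$; $\langle\rangle$ is the empty sequence). A \emph{lambda tree} is a partial function $t:\mathcal P\rightharpoonup\{\lambda,@\}\uplus\mathcal P\uplus\mathcal V$ such that: $p\cdot\langle 0\rangle\in\mathrm{dom}(t)$ implies $t(p)=\lambda$; $p\cdot\langle 1\rangle\in\mathrm{dom}(t)$ or $p\cdot\langle 2\rangle\in\mathrm{dom}(t)$ implies $t(p)=@$; and $t(p)=q\in\mathcal P$ implies $q\le p$ and $t(q)=\lambda$. (A label in $\mathcal V$ is a free variable, a label $q\in\mathcal P$ is a variable bound by the abstraction at $q$.) The empty partial function is denoted $\bot$. Abstraction $\lambda x.t$, application $t_1\,t_2$ and capture-free substitution $t[x:=s]$ are defined on lambda trees as usual; a lambda tree whose root is labelled $\lambda$ is always regarded as $\lambda x.t$ with $x$ a fresh variable (taken outside $\mathcal V$ if necessary). Let $\bar a=a_0a_1a_2\in\{0,1\}^3$ be a strictness signature. The $\bar a$-depth of a position $\langle i_1,\dots,i_n\rangle$ is $a_{i_1}+\dots+a_{i_n}$.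 A lambda tree $t$ is \emph{$\bar a$-guarded} if there is no infinite sequence over $\{0,1,2\}$ all of whose finite prefixes lie in $\mathrm{dom}(t)$ and have $\bar a$-depth below a common finite bound. Let $\mathcal T$ be the set of $\bar a$-guarded lambda trees, partially ordered by: $s\sqsubseteq t$ iff $\mathrm{dom}(s)\subseteq\mathrm{dom}(t)$, $s(p)=t(p)$ for all $p\in\mathrm{dom}(s)$, and $p\in\mathrm{dom}(s)$ implies $p\cdot\langle i\rangle\in\mathrm{dom}(s)$ whenever $a_i=0$ and $p\cdot\langle i\rangle\in\mathrm{dom}(t)$. Let $\beta$ be the rewrite system with the rules $(\lambda x.t)\,s\to t[x:=s]$, and let $\beta\bot$ be its extension by the rules $\lambda x.\bot\to\bot$ if $a_0=0$, $\;\bot\,t\to\bot$ if $a_1=0$, and $t\,\bot\to\bot$ if $a_2=0$. For $R\in\{\beta,\beta\bot\}$, an $R$-reduction step $s\to_p t$ at position $p$ between trees in $\mathcal T$ is the application of a rule of $R$ to the subtree at $p$ (at any position, also below abstractions). Its \emph{reduction context} is the greatest $c\in\mathcal T$ with $c\sqsubseteq s$, $c\sqsubseteq t$ and $p\notin\mathrm{dom}(c)$.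 A tree in $\mathcal T$ is an \emph{$R$-normal form} if no $R$-reduction step starts from it. An $R$-reduction of ordinal length $\alpha$ from $t_0$ consists of steps $t_\iota\to_{p_\iota}t_{\iota+1}$ with reduction contexts $c_\iota$, for $\iota<\alpha$. It \emph{$p$-converges} to $t_\alpha$ if for every limit ordinal $\gamma\le\alpha$ (so $\gamma\neq0$) $$t_\gamma=\liminf_{\iota\to\gamma}c_\iota=\bigsqcup_{\beta<\gamma}\ \bigsqcap_{\beta\le\iota<\gamma}c_\iota\quad\text{in }(\mathcal T,\sqsubseteq).$$ \textbf{Theorem.} For every strictness signature $\bar a$ and every $\bar a$-guarded lambda tree $s$: there is a $\beta$-reduction from $s$ that $p$-converges to a $\beta$-normal form, and there is a $\beta\bot$-reduction from $s$ that $p$-converges to a $\beta\bot$-normal form. -/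

import Mathlib

universe u

noncomputable section

namespace InfinitaryLambda

/-! ### Positions and strictness signatures -/

/-- Positions: finite sequences over `{0, 1, 2}`. Direction `0` enters the body of an abstraction,
`1` and `2` enter the left and the right part of an application. -/
abbrev Pos : Type := List (Fin 3)

/-- A strictness signature `a₀a₁a₂`; `a i = true` is `aᵢ = 1` (non-strict),
`a i = false` is `aᵢ = 0` (strict). -/
abbrev Signature : Type := Fin 3 → Bool

/-- The `a`-depth of a position: depth of `⟨⟩` is `0`, depth of `q·⟨i⟩` is depth of `q` plus `aᵢ`. -/
def depth (a : Signature) (p : Pos) : ℕ := p.countP a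

/-! ### Lambda trees -/

/-- Labels: abstraction, application, a variable bound by the abstraction at a position,
a free variable. -/
inductive Label (V : Type u) : Type u
  | lam : Label V
  | app : Label V
  | bvar (q : Pos) : Label V
  | fvar (x : V) : Label V

/-- Prefix all binding positions by `r`; leave the other labels alone. -/
def Label.shift {V : Type u} (r : Pos) : Label V → Label V
  | .lam => .lam
  | .app => .app
  | .bvar q => .bvar (r ++ q)
  | .fvar x => .fvar x

/-- Relabelling used by abstraction over the variable `none`: it becomes bound at the root. -/
def Label.bind {V : Type u} : Label (Option V) → Label V
  | .lam => .lam
  | .app => .app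
  | .bvar q => .bvar (0 :: q)
  | .fvar none => .bvar []
  | .fvar (some x) => .fvar x

/-- A label other than the variable `none`, read as a label over `V`. -/
def Label.lower {V : Type u} : Label (Option V) → Option (Label V)
  | .lam => some .lam
  | .app => some .app
  | .bvar q => some (.bvar q)
  | .fvar none => none
  | .fvar (some x) => some (.fvar x)

/-- A lambda tree over the set `V` of variables: a partial function from positions to labels
(`none` is "undefined"). -/
@[ext]
structure LambdaTree (V : Type u) : Type u where
  label : Pos → Option (Label V)
  lam_of_child : ∀ p, label (p ++ [0]) ≠ none → label p = some .lam
  app_of_child : ∀ p, label (p ++ [1]) ≠ none ∨ label (p ++ [2]) ≠ none → label p = some .app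
  binder : ∀ p q, label p = some (.bvar q) → q <+: p ∧ label q = some .lam

namespace LambdaTree

variable {V : Type u}

/-- The domain of a lambda tree. -/
def dom (t : LambdaTree V) : Set Pos := {p | t.label p ≠ none}

/-- The empty lambda tree `⊥`. -/
def bot : LambdaTree V where
  label _ := none
  lam_of_child := by simp
  app_of_child := by simp
  binder := by simp

/-- The labelling of the abstraction over the variable `none`. -/
def absLabel (t : LambdaTree (Option V)) : Pos → Option (Label V)
  | [] => some .lam
  | i :: p => if i = 0 then (t.label p).map Label.bind else none

/-- The abstraction `λx.t`. The abstracted variable `x` is the element `none` of `Option V`, the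
variables of the body other than `x` are the `some y` with `y : V`. So `x` is always fresh, and
every lambda tree over `V` with `λ` at its root is `abs t` for exactly one `t`. -/
def abs (t : LambdaTree (Option V)) : LambdaTree V where
  label := absLabel t
  lam_of_child := by
    rintro (_ | ⟨i, p⟩) h
    · rfl
    · by_cases hi : i = 0
      · simp only [List.cons_append, absLabel, hi, if_true, ne_eq, Option.map_eq_none_iff] at h ⊢
        rw [t.lam_of_child p h]; rfl
      · simp [absLabel, hi] at h
  app_of_child := by
    rintro (_ | ⟨i, p⟩) h
    · simp [absLabel] at h
    · by_cases hi : i = 0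
      · simp only [List.cons_append, absLabel, hi, if_true, ne_eq, Option.map_eq_none_iff] at h ⊢
        rw [t.app_of_child p h]; rfl
      · simp [absLabel, hi] at h
  binder := by
    rintro (_ | ⟨i, p⟩) q h
    · simp [absLabel] at h
    · by_cases hi : i = 0
      · subst hi
        simp only [absLabel, if_true, Option.map_eq_some_iff] at h
        obtain ⟨l, hl, hq⟩ := h
        rcases l with _ | _ | q' | (_ | x) <;> simp only [Label.bind, reduceCtorEq,
          Label.bvar.injEq] at hq
        · subst hq
          obtain ⟨h1, h2⟩ := t.binder p q' hl
          refine ⟨by simpa using h1, ?_⟩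
          simp [absLabel, h2, Label.bind]
        · subst hq
          exact ⟨List.nil_prefix, rfl⟩
      · simp [absLabel, hi] at h

/-- The labelling of an application. -/
def appLabel (t₁ t₂ : LambdaTree V) : Pos → Option (Label V)
  | [] => some .app
  | i :: p =>
    if i = 1 then (t₁.label p).map (Label.shift [1])
    else if i = 2 then (t₂.label p).map (Label.shift [2])
    else none

/-- The application `t₁ t₂`. -/
def app (t₁ t₂ : LambdaTree V) : LambdaTree V where
  label := appLabel t₁ t₂
  lam_of_child := by
    rintro (_ | ⟨i, p⟩) h
    · simp [appLabel] at h
    · fin_cases i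
      · simp [appLabel] at h
      · simp [appLabel] at h ⊢
        exact ⟨_, t₁.lam_of_child p h, rfl⟩
      · simp [appLabel] at h ⊢
        exact ⟨_, t₂.lam_of_child p h, rfl⟩
  app_of_child := by
    rintro (_ | ⟨i, p⟩) h
    · rfl
    · fin_cases i
      · simp [appLabel] at h
      · simp [appLabel] at h ⊢
        exact ⟨_, t₁.app_of_child p h, rfl⟩
      · simp [appLabel] at h ⊢
        exact ⟨_, t₂.app_of_child p h, rfl⟩
  binder := by
    rintro (_ | ⟨i, p⟩) q h
    · simp [appLabel] at h
    · fin_cases i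
      · simp [appLabel] at h
      · simp [appLabel] at h
        obtain ⟨l, hl, hq⟩ := h
        rcases l with _ | _ | q' | x <;> simp [Label.shift] at hq
        subst hq
        obtain ⟨h1, h2⟩ := t₁.binder p q' hl
        exact ⟨by simpa using h1, by simp [appLabel, h2, Label.shift]⟩
      · simp [appLabel] at h
        obtain ⟨l, hl, hq⟩ := h
        rcases l with _ | _ | q' | x <;> simp [Label.shift] at hq
        subst hq
        obtain ⟨h1, h2⟩ := t₂.binder p q' hl
        exact ⟨by simpa using h1, by simp [appLabel, h2, Label.shift]⟩

open Classical in
/-- The labelling of `t[x := s]`, where `x` is the variable `none` of `t`: if `p = p₁·p₂` with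
`t(p₁) = x`, it is the label of `s` at `p₂`, moved to `p₁`; otherwise it is the label of `t` at `p`.
(Variables label leaves only, so that the splitting of `p` is unique.) -/
def substLabel (t : LambdaTree (Option V)) (s : LambdaTree V) (p : Pos) : Option (Label V) :=
  if h : ∃ n, t.label (p.take n) = some (.fvar none) then
    (s.label (p.drop (Nat.find h))).map (Label.shift (p.take (Nat.find h)))
  else (t.label p).bind Label.lower

theorem inner_of_dom (t : LambdaTree V) (p r : Pos) (hr : r ≠ [])
    (h : t.label (p ++ r) ≠ none) : t.label p = some .lam ∨ t.label p = some .app := by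
  induction r using List.reverseRecOn with
  | nil => exact absurd rfl hr
  | append_singleton r i ih =>
    rw [← List.append_assoc] at h
    have key : t.label (p ++ r) = some .lam ∨ t.label (p ++ r) = some .app := by
      fin_cases i
      · exact Or.inl (t.lam_of_child _ h)
      · exact Or.inr (t.app_of_child _ (Or.inl h))
      · exact Or.inr (t.app_of_child _ (Or.inr h))
    by_cases hr' : r = []
    · simpa [hr'] using key
    · exact ih hr' (by rcases key with k | k <;> simp [k])

theorem substLabel_of_var (t : LambdaTree (Option V)) (s : LambdaTree V) (p₁ p₂ : Pos)
    (h : t.label p₁ = some (.fvar none)) :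
    substLabel t s (p₁ ++ p₂) = (s.label p₂).map (Label.shift p₁) := by
  classical
  have hex : ∃ n, t.label ((p₁ ++ p₂).take n) = some (.fvar none) := ⟨p₁.length, by simpa using h⟩
  have hfind : Nat.find hex = p₁.length := by
    rw [Nat.find_eq_iff]
    refine ⟨by simpa using h, fun n hn hc => ?_⟩
    rw [List.take_append_of_le_length hn.le] at hc
    have h1 : t.label (p₁.take n ++ p₁.drop n) ≠ none := by simp [h]
    rcases t.inner_of_dom _ _ (by simp [hn]) h1 with k | k <;> simp [k] at hc
  unfold substLabel
  rw [dif_pos hex, hfind]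
  simp

theorem substLabel_of_not_var (t : LambdaTree (Option V)) (s : LambdaTree V) (p : Pos)
    (h : ∀ q, q <+: p → t.label q ≠ some (.fvar none)) :
    substLabel t s p = (t.label p).bind Label.lower := by
  unfold substLabel
  rw [dif_neg]
  rintro ⟨n, hn⟩
  exact h _ (List.take_prefix n p) hn

theorem substLabel_child (t : LambdaTree (Option V)) (s : LambdaTree V) (p : Pos) (i : Fin 3)
    (l : Label V) (l' : Label (Option V)) (hl' : l'.lower = some l) (hsh : ∀ r, l.shift r = l)
    (ht : t.label (p ++ [i]) ≠ none → t.label p = some l')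
    (hs : ∀ q, s.label (q ++ [i]) ≠ none → s.label q = some l)
    (h : substLabel t s (p ++ [i]) ≠ none) : substLabel t s p = some l := by
  by_cases hp : ∃ q, q <+: p ∧ t.label q = some (.fvar none)
  · obtain ⟨q, ⟨r, rfl⟩, hq⟩ := hp
    rw [List.append_assoc, substLabel_of_var t s _ _ hq] at h
    rw [substLabel_of_var t s _ _ hq, hs r (by simpa using h)]
    simp [hsh]
  · push Not at hp
    rw [substLabel_of_not_var t s p hp]
    rw [ht, Option.bind_some, hl']
    by_cases hc : t.label (p ++ [i]) = some (.fvar none)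
    · simp [hc]
    · rw [substLabel_of_not_var t s (p ++ [i])] at h
      · intro h0
        simp [h0] at h
      · intro q hq
        rcases List.prefix_concat_iff.mp hq with rfl | hq
        · exact hc
        · exact hp q hq

/-- The substitution `t[x := s]` of `s` for the variable `x = none` in `t`. -/
def subst (t : LambdaTree (Option V)) (s : LambdaTree V) : LambdaTree V where
  label := substLabel t s
  lam_of_child p h :=
    substLabel_child t s p 0 .lam .lam rfl (fun _ => rfl) (t.lam_of_child p) s.lam_of_child h
  app_of_child p h := by
    rcases h with h | h
    · exact substLabel_child t s p 1 .app .app rfl (fun _ => rfl)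
        (fun k => t.app_of_child p (Or.inl k)) (fun q k => s.app_of_child q (Or.inl k)) h
    · exact substLabel_child t s p 2 .app .app rfl (fun _ => rfl)
        (fun k => t.app_of_child p (Or.inr k)) (fun q k => s.app_of_child q (Or.inr k)) h
  binder p q h := by
    by_cases hp : ∃ q, q <+: p ∧ t.label q = some (.fvar none)
    · obtain ⟨p₁, ⟨r, rfl⟩, hp₁⟩ := hp
      rw [substLabel_of_var t s _ _ hp₁, Option.map_eq_some_iff] at h
      obtain ⟨l, hl, hq⟩ := h
      rcases l with _ | _ | q' | x <;> simp [Label.shift] at hq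
      subst hq
      obtain ⟨h1, h2⟩ := s.binder r q' hl
      refine ⟨by simpa using h1, ?_⟩
      rw [substLabel_of_var t s _ _ hp₁, h2]
      rfl
    · push Not at hp
      rw [substLabel_of_not_var t s p hp, Option.bind_eq_some_iff] at h
      obtain ⟨l, hl, hq⟩ := h
      rcases l with _ | _ | q' | (_ | x) <;> simp [Label.lower] at hq
      subst hq
      obtain ⟨h1, h2⟩ := t.binder p q' hl
      refine ⟨h1, ?_⟩
      rw [substLabel_of_not_var t s q' (fun r hr => hp r (hr.trans h1)), h2]
      rfl

/-- An infinite branch of `t`: an infinite sequence of directions all of whose finite prefixes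
are in the domain of `t`. -/
def IsInfiniteBranch (t : LambdaTree V) (S : ℕ → Fin 3) : Prop :=
  ∀ n, (List.range n).map S ∈ t.dom

/-- `t` is `a`-guarded: no infinite branch of `t` has bounded `a`-depth along it. -/
def Guarded (a : Signature) (t : LambdaTree V) : Prop :=
  ¬ ∃ S, t.IsInfiniteBranch S ∧ ∃ n, ∀ k, depth a ((List.range k).map S) < n

end LambdaTree

/-! ### The partially ordered set of guarded lambda trees -/

/-- The `a`-guarded lambda trees. -/
def GuardedTree (a : Signature) (V : Type u) : Type u := {t : LambdaTree V // t.Guarded a}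

/-- The order `s ≤ t`: `t` agrees with `s` on the domain of `s`, and no hole of `s` at a strict
position is filled in `t`. -/
instance (a : Signature) (V : Type u) : PartialOrder (GuardedTree a V) where
  le s t := s.1.dom ⊆ t.1.dom ∧ (∀ p ∈ s.1.dom, s.1.label p = t.1.label p) ∧
    ∀ p i, a i = false → p ∈ s.1.dom → p ++ [i] ∈ t.1.dom → p ++ [i] ∈ s.1.dom
  le_refl s := ⟨subset_rfl, fun _ _ => rfl, fun _ _ _ _ h => h⟩
  le_trans s t v := by
    rintro ⟨h1, h2, h3⟩ ⟨k1, k2, k3⟩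
    exact ⟨h1.trans k1, fun p hp => (h2 p hp).trans (k2 p (h1 hp)),
      fun p i ha hp hpi => h3 p i ha hp (k3 p i ha (h1 hp) hpi)⟩
  le_antisymm s t := by
    rintro ⟨h1, h2, _⟩ ⟨k1, _, _⟩
    refine Subtype.ext (LambdaTree.ext (funext fun p => ?_))
    by_cases hp : p ∈ s.1.dom
    · exact h2 p hp
    · have hp' : p ∉ t.1.dom := fun h => hp (k1 h)
      simp only [LambdaTree.dom, Set.mem_ofPred_eq, not_not] at hp hp'
      rw [hp, hp']

/-! ### Rewrite systems and reduction steps -/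

/-- A rewrite system: a relation on lambda trees (given for every set of variables, as abstraction
changes it) with no rule that rewrites `⊥`. Reductions below run through guarded trees only;
subtrees of guarded trees are guarded, so they use rules between guarded trees only. -/
structure RewriteSystem : Type (u + 1) where
  rel : ∀ {V : Type u}, LambdaTree V → LambdaTree V → Prop
  ne_bot : ∀ {V : Type u} {s t : LambdaTree V}, rel s t → s ≠ LambdaTree.bot

/-- `(λx.t) s → t[x := s]`. -/
inductive BetaRel {V : Type u} : LambdaTree V → LambdaTree V → Prop
  | beta (t : LambdaTree (Option V)) (s : LambdaTree V) : BetaRel (t.abs.app s) (t.subst s)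

/-- `t₁ t₂ → ⊥` if `tᵢ = ⊥` and `aᵢ = 0` for `i = 1` or `i = 2`, and `λx.⊥ → ⊥` if `a₀ = 0`. -/
inductive StrictRel (a : Signature) {V : Type u} : LambdaTree V → LambdaTree V → Prop
  | abs : a 0 = false → StrictRel a (LambdaTree.abs .bot) .bot
  | left (t : LambdaTree V) : a 1 = false → StrictRel a (LambdaTree.app .bot t) .bot
  | right (t : LambdaTree V) : a 2 = false → StrictRel a (LambdaTree.app t .bot) .bot

theorem LambdaTree.abs_ne_bot {V : Type u} (t : LambdaTree (Option V)) : t.abs ≠ bot := by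
  intro h
  have := congrFun (congrArg LambdaTree.label h) []
  simp [LambdaTree.abs, absLabel, bot] at this

theorem LambdaTree.app_ne_bot {V : Type u} (t s : LambdaTree V) : t.app s ≠ bot := by
  intro h
  have := congrFun (congrArg LambdaTree.label h) []
  simp [LambdaTree.app, appLabel, bot] at this

/-- The rewrite system `β`. -/
def beta : RewriteSystem.{u} where
  rel := BetaRel
  ne_bot := by rintro V _ _ ⟨t, s⟩; exact LambdaTree.app_ne_bot _ _

/-- The rewrite system `β⊥`: the union of the `β`-rules and the strictness rules. -/
def betaBot (a : Signature) : RewriteSystem.{u} where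
  rel s t := BetaRel s t ∨ StrictRel a s t
  ne_bot := by
    rintro V _ _ (⟨t, s⟩ | _ | _ | _)
    · exact LambdaTree.app_ne_bot _ _
    · exact LambdaTree.abs_ne_bot _
    · exact LambdaTree.app_ne_bot _ _
    · exact LambdaTree.app_ne_bot _ _

/-- `Step R p s t`: an `R`-reduction step from `s` to `t` at position `p`. -/
inductive Step (R : RewriteSystem.{u}) :
    {V : Type u} → Pos → LambdaTree V → LambdaTree V → Prop
  | root {V : Type u} {s t : LambdaTree V} : R.rel s t → Step R [] s t
  | abs {V : Type u} {p : Pos} {t t' : LambdaTree (Option V)} :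
      Step R p t t' → Step R (0 :: p) t.abs t'.abs
  | left {V : Type u} {p : Pos} {t t' : LambdaTree V} (s : LambdaTree V) :
      Step R p t t' → Step R (1 :: p) (t.app s) (t'.app s)
  | right {V : Type u} {p : Pos} {t t' : LambdaTree V} (s : LambdaTree V) :
      Step R p t t' → Step R (2 :: p) (s.app t) (s.app t')

variable {a : Signature} {V : Type u}

/-- `t` is an `R`-normal form: no `R`-reduction step starts from `t`. -/
def IsNormalForm (R : RewriteSystem.{u}) (t : GuardedTree a V) : Prop :=
  ¬ ∃ (p : Pos) (t' : GuardedTree a V), Step R p t.1 t'.1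

/-! ### Transfinite reductions and their convergence -/

/-- `c` is the reduction context of a step from `s` to `t` at `p`: the greatest guarded lambda tree
below `s` and `t` that does not have `p` in its domain. -/
def IsReductionContext (p : Pos) (s t c : GuardedTree a V) : Prop :=
  IsGreatest {c : GuardedTree a V | c ≤ s ∧ c ≤ t ∧ p ∉ c.1.dom} c

/-- `t` is the limit inferior of `c ι` as `ι` tends to `γ`, i.e. the least upper bound over `β < γ`
of the greatest lower bounds of `{c ι | β ≤ ι < γ}`. -/
def IsLiminf (γ : Ordinal.{0}) (c : Ordinal.{0} → GuardedTree a V) (t : GuardedTree a V) : Prop :=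
  ∃ g : Ordinal.{0} → GuardedTree a V,
    (∀ β < γ, IsGLB (c '' Set.Ico β γ) (g β)) ∧ IsLUB (g '' Set.Iio γ) t

/-- An `R`-reduction of length `α`, i.e. a sequence of reduction steps `t ι → t (ι + 1)` at `p ι` for
`ι < α`, together with its final tree `t α`. Values of `t` beyond `α`, and of `p` from `α` on, are
irrelevant. -/
structure Reduction (R : RewriteSystem.{u}) (a : Signature) (V : Type u) (α : Ordinal.{0}) where
  tree : Ordinal.{0} → GuardedTree a V
  pos : Ordinal.{0} → Pos
  step : ∀ ι < α, Step R (pos ι) (tree ι).1 (tree (ι + 1)).1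

/-- The reduction `p`-converges (to its final tree): at each limit ordinal `γ ≤ α`, the tree `t γ` is
the limit inferior of the contexts of the preceding reduction steps. -/
def Reduction.PConverges {R : RewriteSystem.{u}} {α : Ordinal.{0}} (S : Reduction R a V α) : Prop :=
  ∃ c : Ordinal.{0} → GuardedTree a V,
    (∀ ι < α, IsReductionContext (S.pos ι) (S.tree ι) (S.tree (ι + 1)) (c ι)) ∧
    ∀ γ ≤ α, Order.IsSuccLimit γ → IsLiminf γ c (S.tree γ)

/-- There is a `p`-convergent `R`-reduction from `s` to `t`. -/
def PReduces (R : RewriteSystem.{u}) (s t : GuardedTree a V) : Prop :=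
  ∃ (α : Ordinal.{0}) (S : Reduction R a V α), S.tree 0 = s ∧ S.tree α = t ∧ S.PConverges

end InfinitaryLambda

end

open InfinitaryLambda

namespace InfinitaryLambda

variable {a : Signature} {V : Type u}

/-! ### Domains and regions -/

/-! The argument works for every rewrite system that does not rewrite ⊥; neither confluence nor the
shape of the rules matters. The order only allows a tree to be cut along a region. Hence the
reduction context of a step at `p` is the redex tree cut to the largest region missing `p`, and this
region also misses every `q` of which `p` is a strict descendant.

Call a region stable for `t` if no reduction from `t` ever contracts a redex in it; stable regions
only grow along reductions. The heart is `exists_reduces_mem_stableRegion_of_prefixes`: if all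
proper prefixes of `q` are stable, some reduct makes `q` stable. Otherwise every reduct can be
reduced further to a contraction in the strict cone of `q`. After ω rounds of this the contexts have
lacked `q` cofinally often, so the limit has a hole at `q` (`IsLiminf.notMem_dom`). No later step
fills the hole, since that would take a contraction at a proper prefix of `q` (`Run.notMem_dom`); so
the cone is stable after all.

Positions are countable. Stabilizing them one after another and concatenating the ω reductions gives
a limit that is stable everywhere, hence a normal form. Limits exist because nonempty sets of
guarded trees have meets and directed sets have joins. -/

theorem LambdaTree.mem_dom_of_append_singleton (t : LambdaTree V) {p : Pos} {i : Fin 3}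
    (h : p ++ [i] ∈ t.dom) : p ∈ t.dom := by
  rcases t.inner_of_dom p [i] (by simp) h with k | k <;> simp [LambdaTree.dom, k]

theorem LambdaTree.mem_dom_of_prefix (t : LambdaTree V) {p q : Pos} (hqp : q <+: p)
    (h : p ∈ t.dom) : q ∈ t.dom := by
  obtain ⟨r, rfl⟩ := hqp
  induction r using List.reverseRecOn with
  | nil => simpa using h
  | append_singleton r i ih =>
    rw [← List.append_assoc] at h
    exact ih (t.mem_dom_of_append_singleton h)

theorem LambdaTree.label_eq_none_iff (t : LambdaTree V) {p : Pos} :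
    t.label p = none ↔ p ∉ t.dom := by
  simp [LambdaTree.dom]

/-- A region is a set of positions that is closed under prefixes and under strict children. -/
structure IsRegion (a : Signature) (D : Set Pos) : Prop where
  of_prefix : ∀ {p q : Pos}, q <+: p → p ∈ D → q ∈ D
  strict : ∀ {p : Pos} {i : Fin 3}, a i = false → p ∈ D → p ++ [i] ∈ D

theorem IsRegion.sUnion {C : Set (Set Pos)} (hC : ∀ D ∈ C, IsRegion a D) :
    IsRegion a (⋃₀ C) where
  of_prefix := by
    rintro p q hqp ⟨D, hD, hp⟩
    exact ⟨D, hD, (hC D hD).of_prefix hqp hp⟩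
  strict := by
    rintro p i hi ⟨D, hD, hp⟩
    exact ⟨D, hD, (hC D hD).strict hi hp⟩

open Classical in
/-- The restriction of a guarded tree to a region: everything outside the region is removed. -/
noncomputable def GuardedTree.restrict (t : GuardedTree a V) {D : Set Pos} (hD : IsRegion a D) :
    GuardedTree a V :=
  ⟨{ label := fun p => if p ∈ D then t.1.label p else none
     lam_of_child := fun p h => by
      by_cases hp : p ++ [0] ∈ D
      · rw [if_pos hp] at h
        rw [if_pos (hD.of_prefix (List.prefix_append _ _) hp)]
        exact t.1.lam_of_child p h
      · simp [hp] at h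
     app_of_child := fun p h => by
      have hp : p ∈ D := by
        rcases h with h | h <;> by_contra hp <;>
          exact h (if_neg fun h' => hp (hD.of_prefix (List.prefix_append _ _) h'))
      rw [if_pos hp]
      refine t.1.app_of_child p (h.imp ?_ ?_) <;>
      · intro h h'
        simp [h'] at h
     binder := fun p q h => by
      by_cases hp : p ∈ D
      · rw [if_pos hp] at h
        obtain ⟨h1, h2⟩ := t.1.binder p q h
        exact ⟨h1, by rw [if_pos (hD.of_prefix h1 hp), h2]⟩
      · simp [hp] at h },
   by
    rintro ⟨S, hS, hb⟩
    refine t.2 ⟨S, fun n => ?_, hb⟩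
    have := hS n
    intro h'
    exact this (by simp [h'])⟩

namespace GuardedTree

theorem restrict_label_of_mem (t : GuardedTree a V) {D : Set Pos} (hD : IsRegion a D) {p : Pos}
    (hp : p ∈ D) : (t.restrict hD).1.label p = t.1.label p := by
  simp [restrict, hp]

theorem mem_dom_restrict {t : GuardedTree a V} {D : Set Pos} {hD : IsRegion a D} {p : Pos} :
    p ∈ (t.restrict hD).1.dom ↔ p ∈ D ∧ p ∈ t.1.dom := by
  by_cases hp : p ∈ D <;> simp [restrict, LambdaTree.dom, hp]

/-- A region is closed under strict children, so cutting to it opens holes only at non-strict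
positions. This is what the third clause of the order demands. -/
theorem restrict_le_of_eqOn {t s : GuardedTree a V} {D : Set Pos} {hD : IsRegion a D}
    (h : ∀ p ∈ D, t.1.label p = s.1.label p) : t.restrict hD ≤ s := by
  refine ⟨fun p hp => ?_, fun p hp => ?_, fun p i hi hp hpi => ?_⟩
  · obtain ⟨h1, h2⟩ := mem_dom_restrict.1 hp
    rwa [LambdaTree.dom, Set.mem_ofPred_eq, ← h p h1]
  · rw [restrict_label_of_mem _ _ (mem_dom_restrict.1 hp).1, h p (mem_dom_restrict.1 hp).1]
  · have := hD.strict hi (mem_dom_restrict.1 hp).1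
    refine mem_dom_restrict.2 ⟨this, ?_⟩
    rwa [LambdaTree.dom, Set.mem_ofPred_eq, h _ this]

theorem restrict_le (t : GuardedTree a V) {D : Set Pos} (hD : IsRegion a D) :
    t.restrict hD ≤ t :=
  restrict_le_of_eqOn fun _ _ => rfl

/-- The positions that are not below a position belonging to `E` but not to the domain of `l`. -/
def avoid (l : GuardedTree a V) (E : Set Pos) : Set Pos :=
  {p | ∀ r, r <+: p → r ∈ E → r ∈ l.1.dom}

/-- `hE` is the third clause of the order, with `E` in the role of the larger domain. These regions
turn an arbitrary tree `l` below others into a cut, which gives the maximality of contexts and of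
meets. -/
theorem isRegion_avoid {l : GuardedTree a V} {E : Set Pos}
    (hE : ∀ p i, a i = false → p ∈ l.1.dom → p ++ [i] ∈ E → p ++ [i] ∈ l.1.dom)
    (hpre : ∀ p i, p ++ [i] ∈ E → p ∈ E) : IsRegion a (avoid l E) where
  of_prefix hqp hp r hr := hp r (hr.trans hqp)
  strict {p i} hi hp r hr hrE := by
    rcases List.prefix_concat_iff.1 hr with rfl | hr
    · exact hE p i hi (hp p List.prefix_rfl (hpre p i hrE)) hrE
    · exact hp r hr hrE

theorem dom_subset_avoid (l : GuardedTree a V) (E : Set Pos) : l.1.dom ⊆ avoid l E :=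
  fun _ hp _ hr _ => l.1.mem_dom_of_prefix hr hp

theorem le_restrict {l t : GuardedTree a V} (hlt : l ≤ t) {D : Set Pos} (hD : IsRegion a D)
    (h : l.1.dom ⊆ D) : l ≤ t.restrict hD :=
  ⟨fun _ hp => mem_dom_restrict.2 ⟨h hp, hlt.1 hp⟩,
    fun p hp => by rw [restrict_label_of_mem _ _ (h hp), hlt.2.1 p hp],
    fun p i hi hp hpi => hlt.2.2 p i hi hp (mem_dom_restrict.1 hpi).2⟩

end GuardedTree

/-! ### Regions missing a given position -/

/-- The largest region that does not contain `p`. -/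
def maxRegion (a : Signature) (p : Pos) : Set Pos := ⋃₀ {D | IsRegion a D ∧ p ∉ D}

theorem isRegion_maxRegion (p : Pos) : IsRegion a (maxRegion a p) :=
  IsRegion.sUnion fun _ h => h.1

theorem notMem_maxRegion (p : Pos) : p ∉ maxRegion a p := by
  rintro ⟨D, ⟨_, h⟩, hp⟩
  exact h hp

theorem subset_maxRegion {p : Pos} {D : Set Pos} (hD : IsRegion a D) (hp : p ∉ D) :
    D ⊆ maxRegion a p :=
  Set.subset_sUnion_of_mem ⟨hD, hp⟩

theorem IsRegion.append_mem {D : Set Pos} (hD : IsRegion a D) {p r : Pos} (hp : p ∈ D)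
    (hr : ∀ i ∈ r, a i = false) : p ++ r ∈ D := by
  induction r using List.reverseRecOn with
  | nil => simpa using hp
  | append_singleton r i ih =>
    rw [← List.append_assoc]
    exact hD.strict (hr i (by simp)) (ih fun j hj => hr j (by simp [hj]))

/-- The strict descendants of `q`. -/
def strictCone (a : Signature) (q : Pos) : Set Pos := {p | ∃ r, p = q ++ r ∧ ∀ i ∈ r, a i = false}

theorem self_mem_strictCone (q : Pos) : q ∈ strictCone a q := ⟨[], by simp, by simp⟩

/-- A region containing `q` contains its whole strict cone. Hence a contraction at `p` erases `q`
from the reduction context. -/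
theorem notMem_maxRegion_of_mem_strictCone {p q : Pos} (hp : p ∈ strictCone a q) :
    q ∉ maxRegion a p := by
  obtain ⟨r, rfl, hr⟩ := hp
  exact fun h => notMem_maxRegion _ ((isRegion_maxRegion _).append_mem h hr)

theorem IsRegion.union_strictCone {D : Set Pos} (hD : IsRegion a D) {q : Pos}
    (hq : ∀ r, r <+: q → r ≠ q → r ∈ D) : IsRegion a (D ∪ strictCone a q) where
  of_prefix := by
    rintro p p' hp' (hp | ⟨r, rfl, hr⟩)
    · exact Or.inl (hD.of_prefix hp' hp)
    · rcases List.prefix_or_prefix_of_prefix hp' (List.prefix_append q r) with h | ⟨r', rfl⟩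
      · by_cases hpq : p' = q
        · exact Or.inr (hpq ▸ self_mem_strictCone p')
        · exact Or.inl (hq p' h hpq)
      · refine Or.inr ⟨r', rfl, fun i hi => hr i ?_⟩
        exact ((List.prefix_append_right_inj q).1 hp').subset hi
  strict := by
    rintro p i hi (hp | ⟨r, rfl, hr⟩)
    · exact Or.inl (hD.strict hi hp)
    · refine Or.inr ⟨r ++ [i], by simp, fun j hj => ?_⟩
      rcases List.mem_append.1 hj with hj | hj
      · exact hr j hj
      · rw [List.mem_singleton.1 hj, hi]

namespace GuardedTree

/-- The tree obtained from `t` by removing as little as possible so that `p` is removed. -/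
noncomputable def context (p : Pos) (t : GuardedTree a V) : GuardedTree a V :=
  t.restrict (isRegion_maxRegion p)

/-- The positions not below a hole of `c` that is filled in `t` form a region; it contains the
domain of `c` and misses `p`. -/
theorem le_context {c t : GuardedTree a V} {p : Pos} (h : c ≤ t) (hp : p ∈ t.1.dom)
    (hpc : p ∉ c.1.dom) : c ≤ context p t := by
  have hR : IsRegion a (avoid c t.1.dom) :=
    isRegion_avoid (fun p i hi => h.2.2 p i hi) fun p i => t.1.mem_dom_of_append_singleton
  refine le_restrict h _ ((dom_subset_avoid c t.1.dom).trans (subset_maxRegion hR fun h' => ?_))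
  exact hpc (h' p List.prefix_rfl hp)

/-! ### Completeness properties of the order -/

/-- The meet is any member of `C`, cut to the largest region on which all members agree,
undefinedness included. For a lower bound `l`, the members agree with `l` away from the holes of `l`
that some member fills, and this set is a region. -/
theorem exists_isGLB {C : Set (GuardedTree a V)} (hC : C.Nonempty) : ∃ m, IsGLB C m := by
  obtain ⟨c₀, h₀⟩ := hC
  let F : Set (Set Pos) := {D | IsRegion a D ∧ ∀ c ∈ C, ∀ p ∈ D, c₀.1.label p = c.1.label p}
  have hF : IsRegion a (⋃₀ F) := IsRegion.sUnion fun _ h => h.1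
  refine ⟨c₀.restrict hF, fun c hc => restrict_le_of_eqOn ?_, fun l hl => ?_⟩
  · rintro p ⟨D, ⟨_, h⟩, hp⟩
    exact h c hc p hp
  · let E : Set Pos := ⋃ c ∈ C, c.1.dom
    have hR : IsRegion a (avoid l E) := by
      refine isRegion_avoid (fun p i hi hp hpi => ?_) fun p i hpi => ?_
      · obtain ⟨c, hc, h⟩ := Set.mem_iUnion₂.1 hpi
        exact (hl hc).2.2 p i hi hp h
      · obtain ⟨c, hc, h⟩ := Set.mem_iUnion₂.1 hpi
        exact Set.mem_iUnion₂.2 ⟨c, hc, c.1.mem_dom_of_append_singleton h⟩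
    have key : ∀ p ∈ avoid l E, ∀ c ∈ C, c.1.label p = l.1.label p := by
      intro p hp c hc
      by_cases hpl : p ∈ l.1.dom
      · exact ((hl hc).2.1 p hpl).symm
      · rw [l.1.label_eq_none_iff.2 hpl, c.1.label_eq_none_iff]
        exact fun h => hpl (hp p List.prefix_rfl (Set.mem_iUnion₂.2 ⟨c, hc, h⟩))
    refine le_restrict (hl h₀) _ ((dom_subset_avoid l E).trans (Set.subset_sUnion_of_mem ?_))
    exact ⟨hR, fun c hc p hp => by rw [key p hp c hc, key p hp c₀ h₀]⟩

open Classical in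
/-- The labelling of the union of a set of guarded trees. -/
noncomputable def unionLabel (G : Set (GuardedTree a V)) (p : Pos) : Option (Label V) :=
  if h : ∃ g ∈ G, p ∈ g.1.dom then h.choose.1.label p else none

theorem unionLabel_eq {G : Set (GuardedTree a V)} (hG : DirectedOn (· ≤ ·) G)
    {g : GuardedTree a V} (hg : g ∈ G) {p : Pos} (hp : p ∈ g.1.dom) :
    unionLabel G p = g.1.label p := by
  have h : ∃ g ∈ G, p ∈ g.1.dom := ⟨g, hg, hp⟩
  obtain ⟨h1, h2⟩ := h.choose_spec
  obtain ⟨k, -, k1, k2⟩ := hG _ h1 _ hg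
  rw [unionLabel, dif_pos h, k1.2.1 p h2, k2.2.1 p hp]

theorem unionLabel_ne_none {G : Set (GuardedTree a V)} (hG : DirectedOn (· ≤ ·) G) {p : Pos} :
    unionLabel G p ≠ none ↔ ∃ g ∈ G, p ∈ g.1.dom := by
  constructor
  · intro h
    by_contra h'
    exact h (dif_neg h')
  · rintro ⟨g, hg, hp⟩
    rwa [unionLabel_eq hG hg hp]

/-- The union of a directed set of guarded trees. -/
noncomputable def unionTree (G : Set (GuardedTree a V)) (hG : DirectedOn (· ≤ ·) G) :
    LambdaTree V where
  label := unionLabel G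
  lam_of_child p h := by
    obtain ⟨g, hg, hp⟩ := (unionLabel_ne_none hG).1 h
    rw [unionLabel_eq hG hg (g.1.mem_dom_of_append_singleton hp)]
    exact g.1.lam_of_child p hp
  app_of_child p h := by
    rcases h with h | h <;> obtain ⟨g, hg, hp⟩ := (unionLabel_ne_none hG).1 h <;>
      rw [unionLabel_eq hG hg (g.1.mem_dom_of_append_singleton hp)]
    · exact g.1.app_of_child p (Or.inl hp)
    · exact g.1.app_of_child p (Or.inr hp)
  binder p q h := by
    obtain ⟨g, hg, hp⟩ := (unionLabel_ne_none hG).1 (h.trans_ne (by simp))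
    rw [unionLabel_eq hG hg hp] at h
    obtain ⟨h1, h2⟩ := g.1.binder p q h
    exact ⟨h1, by rw [unionLabel_eq hG hg (g.1.mem_dom_of_prefix h1 hp), h2]⟩

theorem mem_dom_unionTree {G : Set (GuardedTree a V)} (hG : DirectedOn (· ≤ ·) G) {p : Pos} :
    p ∈ (unionTree G hG).dom ↔ ∃ g ∈ G, p ∈ g.1.dom :=
  unionLabel_ne_none hG

theorem mem_dom_of_mem_dom_unionTree {G : Set (GuardedTree a V)} (hG : DirectedOn (· ≤ ·) G)
    {g : GuardedTree a V} (hg : g ∈ G) {p : Pos} {i : Fin 3} (hi : a i = false)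
    (hp : p ∈ g.1.dom) (hpi : p ++ [i] ∈ (unionTree G hG).dom) : p ++ [i] ∈ g.1.dom := by
  obtain ⟨g', hg', hpi⟩ := (mem_dom_unionTree hG).1 hpi
  obtain ⟨k, -, k1, k2⟩ := hG _ hg _ hg'
  exact k1.2.2 p i hi hp (k2.1 hpi)

theorem depth_append_singleton (p : Pos) (i : Fin 3) :
    depth a (p ++ [i]) = depth a p + if a i then 1 else 0 := by
  simp [depth, List.countP_append, List.countP_cons]

/-- Along a branch of bounded depth the depth is eventually constant, so from some `N` on all
directions are strict. A member of `G` containing the prefix of length `N` then contains the entire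
branch, because its strict holes stay empty in the union. This contradicts its guardedness. -/
theorem guarded_unionTree (G : Set (GuardedTree a V)) (hG : DirectedOn (· ≤ ·) G) :
    (unionTree G hG).Guarded a := by
  rintro ⟨S, hS, n, hn⟩
  have hstep : ∀ k, (List.range (k + 1)).map S = (List.range k).map S ++ [S k] := fun k => by
    simp [List.range_succ]
  have hmono : Monotone fun k => depth a ((List.range k).map S) :=
    monotone_nat_of_le_succ fun k => by rw [hstep, depth_append_singleton]; omega
  obtain ⟨N, hN⟩ : ∃ N, ∀ k ≥ N, depth a ((List.range k).map S) =
      depth a ((List.range N).map S) := by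
    obtain ⟨_, ⟨N, rfl⟩, hN⟩ := (Set.finite_Iio n).subset
      (Set.range_subset_iff.2 hn) |>.exists_maximal (Set.range_nonempty _)
    refine ⟨N, fun k hk => le_antisymm ?_ (hmono hk)⟩
    exact hN ⟨k, rfl⟩ (hmono hk)
  obtain ⟨g, hg, hgN⟩ := (mem_dom_unionTree hG).1 (hS N)
  refine g.2 ⟨S, fun k => ?_, n, hn⟩
  rcases le_total k N with hk | hk
  · refine g.1.mem_dom_of_prefix ?_ hgN
    obtain ⟨m, rfl⟩ := Nat.exists_eq_add_of_le hk
    rw [List.range_add, List.map_append]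
    exact List.prefix_append _ _
  · induction k, hk using Nat.le_induction with
    | base => exact hgN
    | succ k hk ih =>
      have hd := hN (k + 1) (by omega)
      rw [hstep, depth_append_singleton, hN k hk] at hd
      have hs := hS (k + 1)
      rw [hstep] at hs ⊢
      refine mem_dom_of_mem_dom_unionTree hG hg ?_ ih hs
      by_contra hc
      simp [hc] at hd

theorem exists_isLUB_of_directedOn {G : Set (GuardedTree a V)} (hG : DirectedOn (· ≤ ·) G) :
    ∃ m, IsLUB G m := by
  refine ⟨⟨unionTree G hG, guarded_unionTree G hG⟩, fun g hg => ?_, fun v hv => ?_⟩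
  · exact ⟨fun p hp => (mem_dom_unionTree hG).2 ⟨g, hg, hp⟩, fun p hp => (unionLabel_eq hG hg hp).symm,
      fun p i hi hp hpi => mem_dom_of_mem_dom_unionTree hG hg hi hp hpi⟩
  · refine ⟨fun p hp => ?_, fun p hp => ?_, fun p i hi hp hpi => ?_⟩ <;>
      obtain ⟨g, hg, hp⟩ := (mem_dom_unionTree hG).1 hp
    · exact (hv hg).1 hp
    · exact (unionLabel_eq hG hg hp).trans ((hv hg).2.1 p hp)
    · exact (mem_dom_unionTree hG).2 ⟨g, hg, (hv hg).2.2 p i hi hp hpi⟩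

end GuardedTree

/-! ### Limits inferior -/

/-- The trees that are eventually below `c ι` as `ι` tends to `γ`. -/
def eventualLowerBounds (γ : Ordinal.{0}) (c : Ordinal.{0} → GuardedTree a V) :
    Set (GuardedTree a V) :=
  {l | ∃ β < γ, ∀ ι, β ≤ ι → ι < γ → l ≤ c ι}

theorem exists_isGLB_image_Ico {γ β : Ordinal.{0}} (c : Ordinal.{0} → GuardedTree a V)
    (h : β < γ) : ∃ g, IsGLB (c '' Set.Ico β γ) g :=
  GuardedTree.exists_isGLB ⟨c β, β, ⟨le_rfl, h⟩, rfl⟩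

theorem upperBounds_eventualLowerBounds {γ : Ordinal.{0}} {c g : Ordinal.{0} → GuardedTree a V}
    (hg : ∀ β < γ, IsGLB (c '' Set.Ico β γ) (g β)) :
    upperBounds (eventualLowerBounds γ c) = upperBounds (g '' Set.Iio γ) := by
  ext v
  constructor
  · rintro hv _ ⟨β, hβ, rfl⟩
    exact hv ⟨β, hβ, fun ι h1 h2 => (hg β hβ).1 ⟨ι, ⟨h1, h2⟩, rfl⟩⟩
  · rintro hv l ⟨β, hβ, hl⟩
    refine le_trans ((hg β hβ).2 ?_) (hv ⟨β, hβ, rfl⟩)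
    rintro _ ⟨ι, ⟨h1, h2⟩, rfl⟩
    exact hl ι h1 h2

/-- The meets of the tails are cofinal among the eventual lower bounds. This form avoids choosing
the meets. -/
theorem isLiminf_iff {γ : Ordinal.{0}} {c : Ordinal.{0} → GuardedTree a V}
    {t : GuardedTree a V} : IsLiminf γ c t ↔ IsLUB (eventualLowerBounds γ c) t := by
  constructor
  · rintro ⟨g, hg, ht⟩
    rwa [IsLUB, upperBounds_eventualLowerBounds hg]
  · intro h
    have : ∀ β, ∃ g, β < γ → IsGLB (c '' Set.Ico β γ) g := fun β => by
      by_cases hβ : β < γ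
      · obtain ⟨g, hg⟩ := exists_isGLB_image_Ico c hβ
        exact ⟨g, fun _ => hg⟩
      · exact ⟨t, fun h => absurd h hβ⟩
    choose g hg using this
    refine ⟨g, hg, ?_⟩
    rwa [IsLUB, ← upperBounds_eventualLowerBounds hg]

theorem exists_isLiminf (γ : Ordinal.{0}) (c : Ordinal.{0} → GuardedTree a V) :
    ∃ t, IsLiminf γ c t := by
  simp only [isLiminf_iff]
  refine GuardedTree.exists_isLUB_of_directedOn ?_
  rintro l ⟨β, hβ, hl⟩ l' ⟨β', hβ', hl'⟩
  obtain ⟨g, hg⟩ := exists_isGLB_image_Ico c (max_lt hβ hβ')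
  refine ⟨g, ⟨_, max_lt hβ hβ', fun ι h1 h2 => hg.1 ⟨ι, ⟨h1, h2⟩, rfl⟩⟩, hg.2 ?_, hg.2 ?_⟩ <;>
    rintro _ ⟨ι, ⟨h1, h2⟩, rfl⟩
  · exact hl ι ((le_max_left _ _).trans h1) h2
  · exact hl' ι ((le_max_right _ _).trans h1) h2

theorem eventualLowerBounds_congr {γ : Ordinal.{0}} {c c' : Ordinal.{0} → GuardedTree a V}
    (h : ∀ ι < γ, c ι = c' ι) : eventualLowerBounds γ c = eventualLowerBounds γ c' := by
  ext l
  refine exists_congr fun β => and_congr_right fun _ => forall_congr' fun ι =>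
    imp_congr_right fun _ => ⟨fun k h' => h ι h' ▸ k h', fun k h' => (h ι h').symm ▸ k h'⟩

theorem IsLiminf.congr {γ : Ordinal.{0}} {c c' : Ordinal.{0} → GuardedTree a V}
    {t : GuardedTree a V} (ht : IsLiminf γ c t) (h : ∀ ι < γ, c ι = c' ι) :
    IsLiminf γ c' t := by
  rwa [isLiminf_iff, ← eventualLowerBounds_congr h, ← isLiminf_iff]

theorem isLiminf_add_iff {α δ : Ordinal.{0}} (hδ : 0 < δ) {c : Ordinal.{0} → GuardedTree a V}
    {t : GuardedTree a V} : IsLiminf (α + δ) c t ↔ IsLiminf δ (fun ι => c (α + ι)) t := by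
  rw [isLiminf_iff, isLiminf_iff]
  suffices eventualLowerBounds (α + δ) c = eventualLowerBounds δ fun ι => c (α + ι) by rw [this]
  ext l
  constructor
  · rintro ⟨β, hβ, h⟩
    -- If `β` lies before `α`, the truncated difference is `0`; here `0 < δ` is needed.
    have hlt : β - α < δ := by
      rcases le_total α β with h' | h'
      · rwa [← Ordinal.add_sub_cancel_of_le h', add_lt_add_iff_left] at hβ
      · rwa [Ordinal.sub_eq_zero_iff_le.2 h']
    exact ⟨β - α, hlt, fun ι h1 h2 => h _ (Ordinal.sub_le.1 h1) (by simpa using h2)⟩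
  · rintro ⟨β, hβ, h⟩
    refine ⟨α + β, by simpa using hβ, fun ι h1 h2 => ?_⟩
    obtain ⟨ι, rfl⟩ : ∃ ι', ι = α + ι' :=
      ⟨ι - α, (Ordinal.add_sub_cancel_of_le (le_self_add.trans h1)).symm⟩
    exact h ι (by simpa using h1) (by simpa using h2)

/-- Every eventual lower bound lacks `q`. If `t` had `q`, then `t` with `q` cut away would be a
smaller upper bound. -/
theorem IsLiminf.notMem_dom {γ : Ordinal.{0}} {c : Ordinal.{0} → GuardedTree a V}
    {t : GuardedTree a V} (ht : IsLiminf γ c t) {q : Pos}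
    (h : ∀ β < γ, ∃ ι, β ≤ ι ∧ ι < γ ∧ q ∉ (c ι).1.dom) : q ∉ t.1.dom := by
  rw [isLiminf_iff] at ht
  intro hq
  have hle : t ≤ GuardedTree.context q t := by
    refine ht.2 fun l hl => GuardedTree.le_context (ht.1 hl) hq fun hql => ?_
    obtain ⟨β, hβ, hl⟩ := hl
    obtain ⟨ι, h1, h2, h3⟩ := h β hβ
    exact h3 ((hl ι h1 h2).1 hql)
  exact notMem_maxRegion q (GuardedTree.mem_dom_restrict.1 (hle.1 hq)).1

variable {R : RewriteSystem.{u}}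

/-! ### Reduction steps and their contexts -/

theorem LambdaTree.nil_mem_dom {t : LambdaTree V} (h : t ≠ bot) : [] ∈ t.dom := by
  intro h0
  refine h (LambdaTree.ext (funext fun p => ?_))
  exact t.label_eq_none_iff.2 fun hp => t.mem_dom_of_prefix List.nil_prefix hp h0

theorem Step.mem_dom {p : Pos} {s t : LambdaTree V} (h : Step R p s t) : p ∈ s.dom := by
  induction h with
  | root h => exact LambdaTree.nil_mem_dom (R.ne_bot h)
  | abs _ ih => simpa [LambdaTree.dom, LambdaTree.abs, LambdaTree.absLabel] using ih
  | left _ _ ih => simpa [LambdaTree.dom, LambdaTree.app, LambdaTree.appLabel] using ih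
  | right _ _ ih => simpa [LambdaTree.dom, LambdaTree.app, LambdaTree.appLabel] using ih

theorem Step.label_eq {p : Pos} {s t : LambdaTree V} (h : Step R p s t) {q : Pos}
    (hq : ¬ p <+: q) : s.label q = t.label q := by
  induction h generalizing q with
  | root h => exact absurd List.nil_prefix hq
  | abs _ ih | left _ _ ih | right _ _ ih =>
    rcases q with _ | ⟨i, q⟩
    · rfl
    · fin_cases i <;>
        simp_all [LambdaTree.abs, LambdaTree.absLabel, LambdaTree.app, LambdaTree.appLabel]

/-- A step changes labels only at or below `p`, and a region missing `p` misses everything below it.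
So the context depends on `p` and `s` alone. -/
theorem isReductionContext_context {p : Pos} {s t : GuardedTree a V} (h : Step R p s.1 t.1) :
    IsReductionContext p s t (GuardedTree.context p s) := by
  refine ⟨⟨GuardedTree.restrict_le _ _, GuardedTree.restrict_le_of_eqOn fun q hq =>
    h.label_eq fun hpq => ?_, fun hp => ?_⟩, fun c hc => ?_⟩
  · exact notMem_maxRegion p ((isRegion_maxRegion p).of_prefix hpq hq)
  · exact notMem_maxRegion p (GuardedTree.mem_dom_restrict.1 hp).1
  · exact GuardedTree.le_context hc.1 h.mem_dom hc.2.2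

/-! ### Convergent reductions -/

/-- The trees `T ι` and the positions `P ι` form a convergent reduction of length `α`. -/
structure Run (R : RewriteSystem.{u}) (α : Ordinal.{0}) (T : Ordinal.{0} → GuardedTree a V)
    (P : Ordinal.{0} → Pos) : Prop where
  step : ∀ ι < α, Step R (P ι) (T ι).1 (T (ι + 1)).1
  lim : ∀ γ ≤ α, Order.IsSuccLimit γ → IsLiminf γ (fun ι => GuardedTree.context (P ι) (T ι)) (T γ)

/-- There is a convergent reduction from `s` to `t`. -/
def Reduces (R : RewriteSystem.{u}) (s t : GuardedTree a V) : Prop :=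
  ∃ α T P, Run R α T P ∧ T 0 = s ∧ T α = t

theorem Reduces.pReduces {s t : GuardedTree a V} (h : Reduces R s t) : PReduces R s t := by
  obtain ⟨α, T, P, hr, h0, h1⟩ := h
  exact ⟨α, ⟨T, P, hr.step⟩, h0, h1, fun ι => GuardedTree.context (P ι) (T ι),
    fun ι hι => isReductionContext_context (hr.step ι hι), hr.lim⟩

theorem run_zero (T : Ordinal.{0} → GuardedTree a V) (P : Ordinal.{0} → Pos) : Run R 0 T P where
  step _ hι := absurd hι not_lt_zero
  lim _ hγ h := absurd (le_antisymm hγ zero_le) h.ne_bot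

theorem Reduces.refl (s : GuardedTree a V) : Reduces R s s :=
  ⟨0, fun _ => s, fun _ => [], run_zero _ _, rfl, rfl⟩

open Classical in
theorem exists_run_one {p : Pos} {s t : GuardedTree a V} (h : Step R p s.1 t.1) :
    ∃ T, Run R 1 T (fun _ => p) ∧ T 0 = s ∧ T 1 = t := by
  refine ⟨fun ι => if ι = 0 then s else t, ⟨fun ι hι => ?_, fun γ hγ hl => ?_⟩, by simp, by simp⟩
  · rw [Order.lt_one_iff] at hι
    simpa [hι] using h
  · exact absurd (Ordinal.one_lt_of_isSuccLimit hl) hγ.not_gt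

theorem Run.mono {α δ : Ordinal.{0}} {T : Ordinal.{0} → GuardedTree a V} {P : Ordinal.{0} → Pos}
    (h : Run R α T P) (hδ : δ ≤ α) : Run R δ T P :=
  ⟨fun ι hι => h.step ι (hι.trans_le hδ), fun γ hγ => h.lim γ (hγ.trans hδ)⟩

theorem Run.congr {α : Ordinal.{0}} {T T' : Ordinal.{0} → GuardedTree a V}
    {P P' : Ordinal.{0} → Pos} (h : Run R α T P) (hT : ∀ ι ≤ α, T ι = T' ι)
    (hP : ∀ ι < α, P ι = P' ι) : Run R α T' P' where
  step ι hι := by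
    rw [← hT ι hι.le, ← hP ι hι, ← hT _ (Order.add_one_le_of_lt hι)]
    exact h.step ι hι
  lim γ hγ hl := by
    rw [← hT γ hγ]
    exact (h.lim γ hγ hl).congr fun ι hι => by
      rw [hT ι (hι.le.trans hγ), hP ι (hι.trans_le hγ)]

/-- A limit inferior depends only on a tail of the sequence, so convergence can be checked on the
two pieces separately. -/
theorem run_add_iff {α δ : Ordinal.{0}} {T : Ordinal.{0} → GuardedTree a V}
    {P : Ordinal.{0} → Pos} : Run R (α + δ) T P ↔
      Run R α T P ∧ Run R δ (fun ι => T (α + ι)) (fun ι => P (α + ι)) := by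
  refine ⟨fun h => ⟨h.mono le_self_add, fun ι hι => ?_, fun γ hγ hl => ?_⟩, fun h =>
    ⟨fun ι hι => ?_, fun γ hγ hl => ?_⟩⟩
  · rw [← add_assoc]
    exact h.step _ (by simpa using hι)
  · exact (isLiminf_add_iff (Order.IsSuccLimit.bot_lt hl)).1
      (h.lim (α + γ) (by simpa using hγ) (Ordinal.isSuccLimit_add α hl))
  · rcases lt_or_ge ι α with h' | h'
    · exact h.1.step ι h'
    · obtain ⟨ι, rfl⟩ := exists_add_of_le h'
      rw [add_assoc]
      exact h.2.step ι (by simpa using hι)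
  · rcases le_or_gt γ α with h' | h'
    · exact h.1.lim γ h' hl
    · have hl' := Ordinal.isSuccLimit_sub hl.isSuccPrelimit h'
      obtain ⟨γ, rfl⟩ := exists_add_of_le h'.le
      rw [Ordinal.add_sub_cancel] at hl'
      exact (isLiminf_add_iff (Order.IsSuccLimit.bot_lt hl')).2
        (h.2.lim γ (by simpa using hγ) hl')

open Classical in
/-- The sequence that follows `f` below `α`, and then `g`. -/
noncomputable def glue {X : Type*} (α : Ordinal.{0}) (f g : Ordinal.{0} → X) (ι : Ordinal.{0}) :
    X :=
  if ι < α then f ι else g (ι - α)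

theorem glue_of_lt {X : Type*} {α ι : Ordinal.{0}} {f g : Ordinal.{0} → X} (h : ι < α) :
    glue α f g ι = f ι := if_pos h

theorem glue_add {X : Type*} {α ι : Ordinal.{0}} {f g : Ordinal.{0} → X} :
    glue α f g (α + ι) = g ι := by
  simp [glue, not_lt.2 (le_self_add : α ≤ α + ι)]

theorem glue_of_le {X : Type*} {α ι : Ordinal.{0}} {f g : Ordinal.{0} → X} (hfg : f α = g 0)
    (h : ι ≤ α) : glue α f g ι = f ι := by
  rcases h.lt_or_eq with h | rfl
  · exact glue_of_lt h
  · simp [glue, hfg]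

theorem Run.glue {α δ : Ordinal.{0}} {T T' : Ordinal.{0} → GuardedTree a V}
    {P P' : Ordinal.{0} → Pos} (h : Run R α T P) (h' : Run R δ T' P') (hT : T α = T' 0) :
    Run R (α + δ) (glue α T T') (glue α P P') :=
  run_add_iff.2 ⟨h.congr (fun _ hι => (glue_of_le hT hι).symm) fun _ hι => (glue_of_lt hι).symm,
    h'.congr (fun _ _ => glue_add.symm) fun _ _ => glue_add.symm⟩

theorem Reduces.trans {s t v : GuardedTree a V} (h : Reduces R s t) (h' : Reduces R t v) :
    Reduces R s v := by
  obtain ⟨α, T, P, hr, rfl, rfl⟩ := h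
  obtain ⟨δ, T', P', hr', h0, rfl⟩ := h'
  exact ⟨_, _, _, hr.glue hr' h0.symm, glue_of_le h0.symm zero_le, glue_add⟩

theorem Run.reduces {α ι : Ordinal.{0}} {T : Ordinal.{0} → GuardedTree a V}
    {P : Ordinal.{0} → Pos} (h : Run R α T P) (hι : ι ≤ α) : Reduces R (T 0) (T ι) :=
  ⟨ι, T, P, h.mono hι, rfl, rfl⟩

theorem Run.reduces_of_le {α ι κ : Ordinal.{0}} {T : Ordinal.{0} → GuardedTree a V}
    {P : Ordinal.{0} → Pos} (h : Run R α T P) (hικ : ι ≤ κ) (hκ : κ ≤ α) :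
    Reduces R (T ι) (T κ) := by
  obtain ⟨δ, rfl⟩ := exists_add_of_le hικ
  exact ⟨δ, _, _, (run_add_iff.1 (h.mono hκ)).2, by simp, rfl⟩

/-! ### Concatenation of infinitely many reductions -/

/-- The concatenation of the first `n` reductions: its length, its trees and its positions. -/
noncomputable def concat (δ : ℕ → Ordinal.{0}) (T : ℕ → Ordinal.{0} → GuardedTree a V)
    (P : ℕ → Ordinal.{0} → Pos) :
    ℕ → Ordinal.{0} × (Ordinal.{0} → GuardedTree a V) × (Ordinal.{0} → Pos)
  | 0 => (0, T 0, P 0)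
  | n + 1 =>
    let C := concat δ T P n
    (C.1 + δ n, glue C.1 C.2.1 (T n), glue C.1 C.2.2 (P n))

section concat

variable {δ : ℕ → Ordinal.{0}} {T : ℕ → Ordinal.{0} → GuardedTree a V}
  {P : ℕ → Ordinal.{0} → Pos}

theorem concat_end (hT : ∀ n, T n (δ n) = T (n + 1) 0) (n : ℕ) :
    (concat δ T P n).2.1 (concat δ T P n).1 = T n 0 := by
  cases n with
  | zero => rfl
  | succ n => exact glue_add.trans (hT n)

theorem run_concat (hR : ∀ n, Run R (δ n) (T n) (P n)) (hT : ∀ n, T n (δ n) = T (n + 1) 0)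
    (n : ℕ) : Run R (concat δ T P n).1 (concat δ T P n).2.1 (concat δ T P n).2.2 := by
  induction n with
  | zero => exact run_zero _ _
  | succ n ih => exact ih.glue (hR n) (concat_end hT n)

theorem strictMono_concat (hδ : ∀ n, 0 < δ n) : StrictMono fun n => (concat δ T P n).1 :=
  strictMono_nat_of_lt_succ fun n => by simpa [concat] using hδ n

theorem concat_tree_eq (hδ : ∀ n, 0 < δ n) (hT : ∀ n, T n (δ n) = T (n + 1) 0) {n m : ℕ}
    (h : n ≤ m) {ι : Ordinal.{0}} (hι : ι ≤ (concat δ T P n).1) :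
    (concat δ T P m).2.1 ι = (concat δ T P n).2.1 ι := by
  induction m, h using Nat.le_induction with
  | base => rfl
  | succ m h ih =>
    exact (glue_of_le (concat_end hT m)
      (hι.trans ((strictMono_concat hδ).monotone h))).trans ih

theorem concat_pos_eq (hδ : ∀ n, 0 < δ n) {n m : ℕ} (h : n ≤ m) {ι : Ordinal.{0}}
    (hι : ι < (concat δ T P n).1) : (concat δ T P m).2.2 ι = (concat δ T P n).2.2 ι := by
  induction m, h using Nat.le_induction with
  | base => rfl
  | succ m h ih =>
    exact (glue_of_lt (hι.trans_le ((strictMono_concat hδ).monotone h))).trans ih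

end concat

/-- `A n` is the time at which the `n`-th reduction starts. As all lengths are positive, the
supremum `γ` of these times is a limit, and the tree at `γ` can be taken to be the limit inferior of
the contexts. -/
theorem exists_run_concat {δ : ℕ → Ordinal.{0}} {T : ℕ → Ordinal.{0} → GuardedTree a V}
    {P : ℕ → Ordinal.{0} → Pos} (hR : ∀ n, Run R (δ n) (T n) (P n))
    (hT : ∀ n, T n (δ n) = T (n + 1) 0) (hδ : ∀ n, 0 < δ n) :
    ∃ (γ : Ordinal.{0}) (T' : Ordinal.{0} → GuardedTree a V) (P' : Ordinal.{0} → Pos)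
      (A : ℕ → Ordinal.{0}), Run R γ T' P' ∧ Order.IsSuccLimit γ ∧ A 0 = 0 ∧
      (∀ n, A (n + 1) = A n + δ n) ∧ (∀ n, A n < γ) ∧ (∀ ι < γ, ∃ n, ι < A n) ∧
      (∀ n, T' (A n) = T n 0) ∧ ∀ n, ∀ ι < δ n, P' (A n + ι) = P n ι := by
  classical
  let A : ℕ → Ordinal.{0} := fun n => (concat δ T P n).1
  have hA : StrictMono A := strictMono_concat hδ
  let γ : Ordinal.{0} := ⨆ n, A n
  have hle : ∀ n, A n ≤ γ := Ordinal.le_iSup A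
  have hlt : ∀ n, A n < γ := fun n => (hA n.lt_succ_self).trans_le (hle _)
  have hex : ∀ ι < γ, ∃ n, ι < A n := fun ι hι => Ordinal.lt_iSup_iff.1 hι
  have hlim : Order.IsSuccLimit γ := by
    rw [Ordinal.isSuccLimit_iff]
    refine ⟨(zero_le.trans_lt (hlt 0)).ne', Order.isSuccPrelimit_of_succ_lt fun ι hι => ?_⟩
    obtain ⟨n, hn⟩ := hex ι hι
    exact (Order.succ_le_of_lt hn).trans_lt (hlt n)
  let P' : Ordinal.{0} → Pos := fun ι =>
    if h : ∃ n, ι < A n then (concat δ T P (Nat.find h)).2.2 ι else []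
  have hP' : ∀ n ι, ι < A n → P' ι = (concat δ T P n).2.2 ι := fun n ι hι => by
    have h : ∃ n, ι < A n := ⟨n, hι⟩
    simp only [P', dif_pos h]
    exact (concat_pos_eq hδ (Nat.find_min' h hι) (Nat.find_spec h)).symm
  let T₀ : Ordinal.{0} → GuardedTree a V := fun ι =>
    if h : ∃ n, ι < A n then (concat δ T P (Nat.find h)).2.1 ι else T 0 0
  have hT₀ : ∀ n ι, ι < A n → T₀ ι = (concat δ T P n).2.1 ι := fun n ι hι => by
    have h : ∃ n, ι < A n := ⟨n, hι⟩
    simp only [T₀, dif_pos h]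
    exact (concat_tree_eq hδ hT (Nat.find_min' h hι) (Nat.find_spec h).le).symm
  -- The contexts below `γ` do not involve the tree at `γ`, which may therefore be chosen
  -- afterwards. The default values of `P'` and `T₀` occur only from `γ` on.
  obtain ⟨t, ht⟩ := exists_isLiminf γ fun ι => GuardedTree.context (P' ι) (T₀ ι)
  let T' : Ordinal.{0} → GuardedTree a V := fun ι => if ι < γ then T₀ ι else t
  have hT₁ : ∀ ι < γ, T' ι = T₀ ι := fun ι hι => if_pos hι
  have hT' : ∀ n ι, ι ≤ A n → T' ι = (concat δ T P n).2.1 ι := fun n ι hι => by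
    rw [hT₁ ι (hι.trans_lt (hlt n)), hT₀ (n + 1) ι (hι.trans_lt (hA n.lt_succ_self)),
      concat_tree_eq hδ hT n.le_succ hι]
  have hrun : ∀ n, Run R (A n) T' P' := fun n =>
    (run_concat hR hT n).congr (fun ι hι => (hT' n ι hι).symm) fun ι hι => (hP' n ι hι).symm
  refine ⟨γ, T', P', A, ⟨fun ι hι => ?_, fun κ hκ hl => ?_⟩, hlim, rfl, fun _ => rfl, hlt, hex,
    fun n => ?_, fun n ι hι => ?_⟩
  · obtain ⟨n, hn⟩ := hex ι hι
    exact (hrun n).step ι hn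
  · rcases hκ.lt_or_eq with hκ | rfl
    · obtain ⟨n, hn⟩ := hex κ hκ
      exact (hrun n).lim κ hn.le hl
    · have : T' γ = t := if_neg (lt_irrefl γ)
      rw [this]
      exact ht.congr fun ι hι => by rw [hT₁ ι hι]
  · rw [hT' n _ le_rfl]
    exact concat_end hT n
  · have : A n + ι < A (n + 1) := by
      change A n + ι < A n + δ n
      simpa using hι
    rw [hP' (n + 1) _ this]
    exact glue_add

/-! ### Stable regions -/

/-- No reduction from `t` contracts a redex at a position in `D`. -/
def StableOn (R : RewriteSystem.{u}) (t : GuardedTree a V) (D : Set Pos) : Prop :=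
  ∀ t' : GuardedTree a V, Reduces R t t' → ∀ p ∈ D, ∀ t'' : GuardedTree a V, ¬ Step R p t'.1 t''.1

/-- The largest region on which `t` is stable. -/
def stableRegion (R : RewriteSystem.{u}) (t : GuardedTree a V) : Set Pos :=
  ⋃₀ {D | IsRegion a D ∧ StableOn R t D}

theorem isRegion_stableRegion (t : GuardedTree a V) : IsRegion a (stableRegion R t) :=
  IsRegion.sUnion fun _ h => h.1

theorem stableOn_stableRegion (t : GuardedTree a V) : StableOn R t (stableRegion R t) := by
  rintro t' h p ⟨D, hD, hp⟩
  exact hD.2 t' h p hp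

theorem Reduces.stableRegion_subset {s t : GuardedTree a V} (h : Reduces R s t) :
    stableRegion R s ⊆ stableRegion R t :=
  Set.subset_sUnion_of_mem ⟨isRegion_stableRegion s,
    fun t' h' => stableOn_stableRegion s t' (h.trans h')⟩

theorem isNormalForm_of_stableRegion_eq_univ {t : GuardedTree a V}
    (h : stableRegion R t = Set.univ) : IsNormalForm R t := by
  rintro ⟨p, t', ht⟩
  exact stableOn_stableRegion t t (Reduces.refl t) p (h ▸ Set.mem_univ p) t' ht

/-- A hole at `q` changes only by a contraction at a prefix of `q`. Proper prefixes are excluded by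
`hP`, and `q` itself is not in the domain and so carries no redex. At limits all earlier contexts
lack `q`. -/
theorem Run.notMem_dom {α : Ordinal.{0}} {T : Ordinal.{0} → GuardedTree a V}
    {P : Ordinal.{0} → Pos} (h : Run R α T P) {D : Set Pos} (hP : ∀ ι < α, P ι ∉ D) {q : Pos}
    (hq : ∀ r, r <+: q → r ≠ q → r ∈ D) (h0 : q ∉ (T 0).1.dom) {ι : Ordinal.{0}} (hι : ι ≤ α) :
    q ∉ (T ι).1.dom := by
  induction ι using Ordinal.limitRecOn with
  | zero => exact h0
  | add_one ι ih =>
    have hlt : ι < α := Order.add_one_le_iff.1 hι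
    have hqι := ih hlt.le
    have hs := h.step ι hlt
    rw [← LambdaTree.label_eq_none_iff, ← hs.label_eq fun hp => ?_]
    · exact (LambdaTree.label_eq_none_iff _).2 hqι
    · by_cases hpq : P ι = q
      · exact hqι (hpq ▸ hs.mem_dom)
      · exact hP ι hlt (hq _ hp hpq)
  | limit γ hl ih =>
    refine (h.lim γ hι hl).notMem_dom fun β hβ => ⟨β, le_rfl, hβ, fun hqβ => ?_⟩
    exact ih β hβ (hβ.le.trans hι) (GuardedTree.mem_dom_restrict.1 hqβ).2

theorem mem_dom_of_mem_strictCone {t : LambdaTree V} {p q : Pos} (hp : p ∈ strictCone a q)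
    (h : p ∈ t.dom) : q ∈ t.dom := by
  obtain ⟨r, rfl, _⟩ := hp
  exact t.mem_dom_of_prefix (List.prefix_append q r) h

theorem exists_reduces_mem_stableRegion_of_prefixes {t : GuardedTree a V} {q : Pos}
    (hq : ∀ r, r <+: q → r ≠ q → r ∈ stableRegion R t) :
    ∃ t', Reduces R t t' ∧ q ∈ stableRegion R t' := by
  by_contra! H
  have hreg := (isRegion_stableRegion (R := R) t).union_strictCone hq
  have hcone : ∀ t', Reduces R t t' → ∀ p ∈ stableRegion R t ∪ strictCone a q,
      ∀ t'' : GuardedTree a V, Step R p t'.1 t''.1 → p ∈ strictCone a q := fun t' h p hp t'' hs =>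
    hp.resolve_left fun hp => stableOn_stableRegion t t' h p hp t'' hs
  have hnext : ∀ x : {x // Reduces R t x}, ∃ (y : {y // Reduces R t y}) (α : Ordinal.{0})
      (T : Ordinal.{0} → GuardedTree a V) (P : Ordinal.{0} → Pos),
      Run R (α + 1) T P ∧ T 0 = x.1 ∧ T (α + 1) = y.1 ∧ P α ∈ strictCone a q := by
    rintro ⟨x, hx⟩
    -- By `H`, the region enlarged by the cone is stable for no reduct; stability inside the old
    -- region forces the offending contraction into the cone.
    have : ¬ StableOn R x (stableRegion R t ∪ strictCone a q) := fun hst =>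
      H x hx ⟨_, ⟨hreg, hst⟩, Or.inr (self_mem_strictCone q)⟩
    simp only [StableOn] at this
    push Not at this
    obtain ⟨v, hv, p, hp, w, hs⟩ := this
    have hpc := hcone v (hx.trans hv) p hp w hs
    obtain ⟨α, T, P, hr, rfl, rfl⟩ := hv
    obtain ⟨T', hr', h0, h1⟩ := exists_run_one hs
    have hrun := hr.glue hr' h0.symm
    have hzero : glue α T T' 0 = T 0 := glue_of_le h0.symm zero_le
    have hend : glue α T T' (α + 1) = w := glue_add.trans h1
    refine ⟨⟨w, hx.trans ?_⟩, α, _, _, hrun, hzero, hend, ?_⟩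
    · exact ⟨_, _, _, hrun, hzero, hend⟩
    · have : glue α P (fun _ => p) (α + 0) = p := glue_add
      rw [add_zero] at this
      rwa [this]
  choose next α T P hrun hzero hend hpos using hnext
  let x : ℕ → {x // Reduces R t x} := fun n => Nat.rec ⟨t, Reduces.refl t⟩ (fun _ => next) n
  obtain ⟨γ, T', P', A, hr, hl, hA0, hA, hAlt, hex, hT', hP'⟩ :=
    exists_run_concat (fun n => hrun (x n)) (fun n => (hend (x n)).trans (hzero (x (n + 1))).symm)
      (fun n => Order.lt_add_one_iff.2 zero_le)
  have htω : Reduces R t (T' γ) := by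
    refine ⟨γ, T', P', hr, ?_, rfl⟩
    rw [← hA0, hT' 0]
    exact hzero (x 0)
  -- Each round ends with a contraction in the cone, at time `A n + α (x n)`, whose context lacks
  -- `q`; these times are cofinal in `γ`.
  have hqω : q ∉ (T' γ).1.dom := by
    refine (hr.lim γ le_rfl hl).notMem_dom fun β hβ => ?_
    obtain ⟨n, hn⟩ := hex β hβ
    have hlt : A n + α (x n) < A (n + 1) := by
      rw [hA n]
      simp
    refine ⟨A n + α (x n), hn.le.trans le_self_add, hlt.trans (hAlt _), fun hmem => ?_⟩
    have hc : P' (A n + α (x n)) ∈ strictCone a q := by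
      rw [hP' n _ (Order.lt_add_one_iff.2 le_rfl)]
      exact hpos (x n)
    exact notMem_maxRegion_of_mem_strictCone hc (GuardedTree.mem_dom_restrict.1 hmem).1
  -- The enlarged region is stable at the limit: a contraction in the cone would need `q` in the
  -- domain, but the hole at `q` persists.
  refine H _ htω ⟨_, ⟨hreg, fun t' ht' p hp t'' hs => ?_⟩, Or.inr (self_mem_strictCone q)⟩
  have hqt : q ∈ t'.1.dom :=
    mem_dom_of_mem_strictCone (hcone t' (htω.trans ht') p hp t'' hs) hs.mem_dom
  obtain ⟨δ, S, Q, hS, hS0, rfl⟩ := ht'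
  refine hS.notMem_dom (D := stableRegion R t) (fun ι hι hQ => ?_) hq (hS0 ▸ hqω) le_rfl hqt
  exact stableOn_stableRegion t _ (htω.trans (hS0 ▸ hS.reduces hι.le)) _ hQ _ (hS.step ι hι)

theorem exists_reduces_mem_stableRegion (t : GuardedTree a V) (q : Pos) :
    ∃ t', Reduces R t t' ∧ q ∈ stableRegion R t' := by
  induction q using List.reverseRecOn with
  | nil =>
    exact exists_reduces_mem_stableRegion_of_prefixes fun r hr hne =>
      absurd (List.prefix_nil.1 hr) hne
  | append_singleton q i ih =>
    obtain ⟨t', h, hq⟩ := ih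
    obtain ⟨t'', h', hq'⟩ := exists_reduces_mem_stableRegion_of_prefixes (R := R) (t := t')
      (q := q ++ [i]) fun r hr hne => (isRegion_stableRegion t').of_prefix
        ((List.prefix_concat_iff.1 hr).resolve_left hne) hq
    exact ⟨t'', h.trans h', hq'⟩

/-! ### Normalization -/

/-- Stage `n` makes the position `e n` stable. The limit inherits all these stable positions by
monotonicity, so its labels need not be computed. -/
theorem exists_reduces_isNormalForm (R : RewriteSystem.{u}) (s : GuardedTree a V) :
    ∃ t, Reduces R s t ∧ IsNormalForm R t := by
  by_contra! H
  obtain ⟨e, he⟩ := exists_surjective_nat Pos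
  have hnext : ∀ (n : ℕ) (x : {x // Reduces R s x}), ∃ (y : {y // Reduces R s y})
      (δ : Ordinal.{0}) (T : Ordinal.{0} → GuardedTree a V) (P : Ordinal.{0} → Pos),
      Run R δ T P ∧ 0 < δ ∧ T 0 = x.1 ∧ T δ = y.1 ∧ e n ∈ stableRegion R y.1 := by
    rintro n ⟨x, hx⟩
    -- If no reduct is normal, each stage can begin with one step; this makes its length positive,
    -- as concatenation requires.
    obtain ⟨p, x', hs⟩ := not_not.1 (H x hx)
    obtain ⟨T, hr, h0, h1⟩ := exists_run_one hs
    obtain ⟨y, ⟨α, T', P, hr', h0', h1'⟩, hy⟩ := exists_reduces_mem_stableRegion (R := R) x' (e n)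
    have hT : T 1 = T' 0 := h1.trans h0'.symm
    have hrun := hr.glue hr' hT
    have hzero := (glue_of_le hT zero_le).trans h0
    have hend : glue 1 T T' (1 + α) = y := glue_add.trans h1'
    exact ⟨⟨y, hx.trans ⟨_, _, _, hrun, hzero, hend⟩⟩, _, _, _, hrun,
      zero_lt_one.trans_le le_self_add, hzero, hend, hy⟩
  choose next δ T P hrun hδ hzero hend hmem using hnext
  let x : ℕ → {x // Reduces R s x} := fun n => Nat.rec ⟨s, Reduces.refl s⟩ next n
  obtain ⟨γ, T', P', A, hr, -, hA0, -, hAlt, -, hT', -⟩ :=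
    exists_run_concat (fun n => hrun n (x n))
      (fun n => (hend n (x n)).trans (hzero (n + 1) (x (n + 1))).symm) (fun n => hδ n (x n))
  have hT'' : ∀ n, T' (A n) = (x n).1 := fun n => (hT' n).trans (hzero n (x n))
  refine H (T' γ) ⟨γ, T', P', hr, ?_, rfl⟩ (isNormalForm_of_stableRegion_eq_univ ?_)
  · rw [← hA0]
    exact hT'' 0
  · refine Set.eq_univ_of_forall fun q => ?_
    obtain ⟨n, rfl⟩ := he q
    have hred := hr.reduces_of_le (hAlt (n + 1)).le le_rfl
    rw [hT''] at hred
    exact hred.stableRegion_subset (hmem n (x n))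

end InfinitaryLambda

/-! ### The theorem for β and β⊥ -/

theorem mainTheorem2 {V : Type*} [Countable V] [Infinite V] (a : Signature)
    (s : GuardedTree a V) :
    (∃ t : GuardedTree a V, PReduces beta s t ∧ IsNormalForm beta t) ∧
    (∃ t : GuardedTree a V, PReduces (betaBot a) s t ∧ IsNormalForm (betaBot a) t) := by
  obtain ⟨t, ht, hn⟩ := exists_reduces_isNormalForm beta s
  obtain ⟨t', ht', hn'⟩ := exists_reduces_isNormalForm (betaBot a) s
  exact ⟨⟨t, ht.pReduces, hn⟩, t', ht'.pReduces, hn'⟩
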